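/- **Theorem 1 (Hopf).** Let $K\subset\mathbb{R}^2$ be a continuum, that is, a nonempty connected compact set. Let $S(K)$ be the set of real numbers $s\ge 0$ for which there are points $x,x'\in K$ with $x'-x=(s,0)$ (the lengths of the horizontal chords of $K$), and let $S^*(K)=(0,\infty)\setminus S(K)$. Then $S^*(K)$ is additive: if $a,b\in S^*(K)$, then $a+b\in S^*(K)$. **Corollary.** Let $L\ge 0$, let $f:[0,L]\to\mathbb{R}$ be continuous, and let $S=S(K)$ be the horizontal chord set of $f$, where $K=\{(t,f(t)) : t\in[0,L]\}$ is the graph of $f$. Then the complement $S^*=[0,\infty)\setminus S$ is open (as a subset of $\mathbb{R}$) and additive. -/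

import Mathlib

/-- A continuum in the plane: a nonempty connected compact set. -/
def IsPlaneContinuum (K : Set (ℝ × ℝ)) : Prop :=
  K.Nonempty ∧ IsPreconnected K ∧ IsCompact K

/-- The set of lengths of horizontal chords of a subset of the plane. -/
def chordSet (K : Set (ℝ × ℝ)) : Set ℝ :=
  {s | 0 ≤ s ∧ ∃ x ∈ K, ∃ x' ∈ K, x' - x = (s, 0)}

/-- The set of positive real numbers that are not lengths of horizontal chords. -/
def nonChordSet (K : Set (ℝ × ℝ)) : Set ℝ :=
  {s | 0 < s ∧ s ∉ chordSet K}

/-- A set of reals is additive if it is closed under sums of two (possibly equal) elements. -/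
def IsAdditiveSet (X : Set ℝ) : Prop :=
  ∀ a ∈ X, ∀ b ∈ X, a + b ∈ X

/-- The graph, in the plane, of a real function on the interval `[0, L]`. -/
def planeGraph {L : ℝ} (f : Set.Icc (0 : ℝ) L → ℝ) : Set (ℝ × ℝ) :=
  Set.range fun t : Set.Icc (0 : ℝ) L => ((t : ℝ), f t)

/-- The horizontal chord set of a function on `[0, L]` is that of its graph. -/
def functionChordSet {L : ℝ} (f : Set.Icc (0 : ℝ) L → ℝ) : Set ℝ :=
  chordSet (planeGraph f)

/-!
Identify the plane with `ℂ`. Suppose that a continuum `K` has no horizontal chord of length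
`a` or `b`, but has points `x` and `x + (a + b)`. By compactness the same holds for a small
neighbourhood of `K`; being open and connected, it is path connected, so there is a curve `γ` in it
with `γ 1 = γ 0 + (a + b)`. It remains to see that this is impossible (`exists_chord_of_curve`).

The vector `γ t - γ s - a` never vanishes, so, the `(s, t)`-plane being simply connected, it has a
continuous angle `A (s, t)`, equal to `π` on the diagonal (`exists_angle`); let `B` be the
corresponding angle for `b`. As `γ 1 - γ s - a = -(γ s - γ 0 - b)`, the difference
`A (s, 1) - B (0, s)` is constant, and its value at `s = 0` is `A (0, 1) - π`. If `γ u` is a highest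
point of the curve, then `γ t - γ u - a` stays in the lower half-plane and `γ u - γ s - b` in the
upper one, so `A (u, 1) ≥ π ≥ B (0, u)`. At a lowest point the inequalities are reversed. Hence the
constant is zero and `A (0, 1) = π`, although `γ 1 - γ 0 - a = b` is a positive number.

For the graph of a continuous function, openness of the complement is the closedness of the chord
set of a compact set (`isClosed_chordSet`), and `0` is a chord length.
-/

open Set Metric Real

/-- A continuous angle that takes the value `π` and always points into the closed lower
half-plane never leaves `[π, 2π]`. -/
theorem mem_Icc_pi_two_pi_of_sin_nonpos {θ : ℝ → ℝ} (hθ : Continuous θ) {t₀ : ℝ}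
    (h₀ : θ t₀ = π) (hs : ∀ t, sin (θ t) ≤ 0) (t : ℝ) : θ t ∈ Icc π (2 * π) := by
  have hpi := pi_pos
  constructor
  · by_contra! h
    obtain ⟨y, hy⟩ : max (θ t) (π / 2) ∈ range θ :=
      mem_range_of_exists_le_of_exists_ge hθ ⟨t, le_max_left _ _⟩
        ⟨t₀, (max_le h.le (by linarith)).trans_eq h₀.symm⟩
    have := sin_pos_of_pos_of_lt_pi (x := max (θ t) (π / 2))
      (lt_of_lt_of_le (by linarith) (le_max_right _ _)) (max_lt h (by linarith))
    exact (hs y).not_gt (hy ▸ this)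
  · by_contra! h
    obtain ⟨y, hy⟩ : min (θ t) (5 * π / 2) ∈ range θ :=
      mem_range_of_exists_le_of_exists_ge hθ
        ⟨t₀, h₀.trans_le (le_min (by linarith) (by linarith))⟩ ⟨t, min_le_left _ _⟩
    have := sin_pos_of_pos_of_lt_pi (x := min (θ t) (5 * π / 2) - 2 * π)
      (sub_pos.2 (lt_min h (by linarith)))
      (by linarith [min_le_right (θ t) (5 * π / 2)])
    rw [sin_sub_two_pi] at this
    exact (hs y).not_gt (hy ▸ this)

theorem mem_Icc_zero_pi_of_sin_nonneg {θ : ℝ → ℝ} (hθ : Continuous θ) {t₀ : ℝ}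
    (h₀ : θ t₀ = π) (hs : ∀ t, 0 ≤ sin (θ t)) (t : ℝ) : θ t ∈ Icc 0 π := by
  have := mem_Icc_pi_two_pi_of_sin_nonpos (θ := fun t => 2 * π - θ t) (by fun_prop)
    (t₀ := t₀) (by rw [h₀]; ring) (fun t => by simpa [sin_two_pi_sub] using hs t) t
  exact ⟨by linarith [this.2], by linarith [this.1]⟩

/-- Two continuous angle functions of one real variable whose directions differ by
the rotation by a fixed angle `c` differ by a constant. -/
theorem sub_eq_sub_of_circleExp_eq {f g : ℝ → ℝ} (hf : Continuous f) (hg : Continuous g)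
    (c : ℝ) (h : ∀ t, Circle.exp (f t) = Circle.exp (g t + c)) (s t : ℝ) :
    f s - g s = f t - g t := by
  have h₀ : Circle.exp (f t - g t) = Circle.exp c := by
    rw [Circle.exp_sub, h, Circle.exp_add, mul_div_cancel_left _ (Circle.exp c)]
  have := Circle.isCoveringMap_exp.eq_of_comp_eq (g₁ := f) (g₂ := fun x => g x + (f t - g t))
    hf (by fun_prop) (by ext1 x; simp [Circle.exp_add, h, h₀]) t (by ring)
  have := congrFun this s
  linarith

/-- The direction of the vector from `γ s + a` to `γ t` admits a continuous angle in `(s, t)`,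
normalized to be `π` on the diagonal, where the vector is the constant `-a`. -/
theorem exists_angle {γ : ℝ → ℂ} (hγ : Continuous γ) {a : ℝ} (ha : 0 < a)
    (h : ∀ s t, γ t - γ s ≠ a) :
    ∃ A : ℝ × ℝ → ℝ, Continuous A ∧ (∀ s, A (s, s) = π) ∧
      ∀ s t, γ t - γ s - a = ‖γ t - γ s - a‖ * (Circle.exp (A (s, t)) : ℂ) := by
  let V : ℝ × ℝ → ℂ := fun p => γ p.2 - γ p.1 - a
  have hV : Continuous V := by fun_prop
  have hV₀ (p) : (‖V p‖ : ℂ) ≠ 0 :=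
    Complex.ofReal_ne_zero.2 (norm_ne_zero_iff.2 (sub_ne_zero.2 (h _ _)))
  have hmem (p) : V p / ‖V p‖ ∈ Submonoid.unitSphere ℂ := by
    rw [← SetLike.mem_coe]
    simpa using div_self (Complex.ofReal_ne_zero.1 (hV₀ p))
  let F : C(ℝ × ℝ, Circle) :=
    ⟨fun p => ⟨V p / ‖V p‖, hmem p⟩, Continuous.subtype_mk (hV.div (by fun_prop) hV₀) hmem⟩
  have hF (p) : V p = ‖V p‖ * (F p : ℂ) := (mul_div_cancel₀ _ (hV₀ p)).symm
  have hdiag (s) : F (s, s) = Circle.exp π := by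
    apply Circle.ext
    change V (s, s) / ‖V (s, s)‖ = _
    have : (a : ℂ) ≠ 0 := Complex.ofReal_ne_zero.2 ha.ne'
    simp [V, Complex.exp_pi_mul_I, abs_of_pos ha, this]
  obtain ⟨A, ⟨hA₀, hA⟩, -⟩ :=
    Circle.isCoveringMap_exp.existsUnique_continuousMap_lifts F (0, 0) π (hdiag 0).symm
  refine ⟨A, A.continuous, fun s => ?_, fun s t => ?_⟩
  · have := sub_eq_sub_of_circleExp_eq (f := fun s => A (s, s)) (g := fun _ => 0)
      (by fun_prop) (by fun_prop) π
      (fun t => by rw [zero_add, ← hdiag, ← hA]; rfl) s 0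
    simpa [hA₀] using this
  · have := hF (s, t)
    rwa [← hA] at this

/-- A curve from `z` to `z + (a + b)` whose height attains its maximum and minimum contains two
points that differ by `a` or two points that differ by `b`. This is the topological core: the
angles `A`, `B` of `exists_angle` satisfy `A (s, 1) - B (0, s) = A (0, 1) - π` for all `s`, and
evaluating at a highest and a lowest point of the curve shows that both sides vanish. -/
theorem exists_chord_of_curve {γ : ℝ → ℂ} (hγ : Continuous γ) {a b : ℝ} (ha : 0 < a) (hb : 0 < b)
    (hab : γ 1 = γ 0 + (a + b)) {u v : ℝ} (hu : ∀ t, (γ t).im ≤ (γ u).im)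
    (hv : ∀ t, (γ v).im ≤ (γ t).im) :
    ∃ s t, γ t - γ s = a ∨ γ t - γ s = b := by
  by_contra! h
  obtain ⟨A, hA, hAd, hAe⟩ := exists_angle hγ ha fun s t => (h s t).1
  obtain ⟨B, hB, hBd, hBe⟩ := exists_angle hγ hb fun s t => (h s t).2
  have hsin {c : ℝ} {C : ℝ × ℝ → ℝ}
      (hCe : ∀ s t, γ t - γ s - c = ‖γ t - γ s - c‖ * (Circle.exp (C (s, t)) : ℂ)) (s t : ℝ) :
      (γ t).im - (γ s).im = ‖γ t - γ s - c‖ * sin (C (s, t)) := by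
    have := congrArg Complex.im (hCe s t)
    rwa [Complex.im_ofReal_mul, Circle.coe_exp, Complex.exp_ofReal_mul_I_im, Complex.sub_im,
      Complex.sub_im, Complex.ofReal_im, sub_zero] at this
  have hpos {c : ℝ} {s t : ℝ} (h : γ t - γ s ≠ c) : 0 < ‖γ t - γ s - c‖ :=
    norm_pos_iff.2 (sub_ne_zero.2 h)
  -- The vector from `γ s + a` to `γ 1` is opposite to the vector from `γ 0 + b` to `γ s`.
  have hrel (s) : A (s, 1) - B (0, s) = A (0, 1) - π := by
    rw [← hBd 0]
    refine sub_eq_sub_of_circleExp_eq (f := fun s => A (s, 1)) (g := fun s => B (0, s))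
      (by fun_prop) (by fun_prop) π (fun t => ?_) s 0
    have hneg : γ 1 - γ t - a = -(γ t - γ 0 - b) := by rw [hab]; ring
    have h₁ := hAe t 1
    have h₂ := hBe 0 t
    rw [hneg, norm_neg] at h₁
    have hN : (‖γ t - γ 0 - b‖ : ℂ) ≠ 0 := Complex.ofReal_ne_zero.2 (hpos (h 0 t).2).ne'
    apply Circle.ext
    apply mul_left_cancel₀ hN
    rw [← h₁, Circle.exp_add, Circle.coe_mul, ← mul_assoc, ← h₂, Circle.coe_exp π,
      Complex.exp_pi_mul_I, mul_neg_one]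
  have hAu := mem_Icc_pi_two_pi_of_sin_nonpos (θ := fun t => A (u, t)) (by fun_prop) (hAd u)
    (fun t => nonpos_of_mul_nonpos_right
      ((hsin hAe u t).symm.trans_le (sub_nonpos.2 (hu t))) (hpos (h u t).1)) 1
  have hBu := mem_Icc_zero_pi_of_sin_nonneg (θ := fun s => B (s, u)) (by fun_prop) (hBd u)
    (fun s => nonneg_of_mul_nonneg_right
      ((sub_nonneg.2 (hu s)).trans_eq (hsin hBe s u)) (hpos (h s u).2)) 0
  have hAv := mem_Icc_zero_pi_of_sin_nonneg (θ := fun t => A (v, t)) (by fun_prop) (hAd v)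
    (fun t => nonneg_of_mul_nonneg_right
      ((sub_nonneg.2 (hv t)).trans_eq (hsin hAe v t)) (hpos (h v t).1)) 1
  have hBv := mem_Icc_pi_two_pi_of_sin_nonpos (θ := fun s => B (s, v)) (by fun_prop) (hBd v)
    (fun s => nonpos_of_mul_nonpos_right
      ((hsin hBe s v).symm.trans_le (sub_nonpos.2 (hv s))) (hpos (h s v).2)) 0
  have hAπ : A (0, 1) = π := by
    have := hrel u
    have := hrel v
    linarith [hAu.1, hBu.2, hAv.2, hBv.1]
  -- The vector from `γ 0 + a` to `γ 1` is the positive number `b`, so its angle is not `π`.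
  have h₀₁ := hAe 0 1
  have hb' : γ 1 - γ 0 - a = b := by rw [hab]; ring
  rw [hAπ, hb', Circle.coe_exp, Complex.exp_pi_mul_I, Complex.norm_real, norm_of_nonneg hb.le,
    mul_neg_one] at h₀₁
  have : b = -b := by exact_mod_cast h₀₁
  linarith

theorem IsPreconnected.thickening {E : Type*} [SeminormedAddCommGroup E] [NormedSpace ℝ E]
    {K : Set E} (hK : IsPreconnected K) (δ : ℝ) : IsPreconnected (thickening δ K) := by
  rcases le_or_gt δ 0 with hδ | hδ
  · rw [thickening_of_nonpos hδ]
    exact isPreconnected_empty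
  refine isPreconnected_of_forall_pair fun x hx y hy => ?_
  obtain ⟨x', hx', hxx'⟩ := mem_thickening_iff.1 hx
  obtain ⟨y', hy', hyy'⟩ := mem_thickening_iff.1 hy
  have hball {z} (hz : z ∈ K) : ball z δ ⊆ Metric.thickening δ K := fun w hw =>
    mem_thickening_iff.2 ⟨z, hz, hw⟩
  refine ⟨ball x' δ ∪ K ∪ ball y' δ, union_subset (union_subset (hball hx')
    (self_subset_thickening hδ K)) (hball hy'), Or.inl (Or.inl hxx'), Or.inr hyy', ?_⟩
  exact ((convex_ball x' δ).isPreconnected.union x' (mem_ball_self hδ) hx' hK).union y'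
    (Or.inr hy') (mem_ball_self hδ) (convex_ball y' δ).isPreconnected

open Pointwise in
theorem IsCompact.isCompact_sub_self {E : Type*} [SeminormedAddCommGroup E] {K : Set E}
    (hK : IsCompact K) : IsCompact (K - K) := by
  rw [← Set.sub_image_prod]
  exact (hK.prod hK).image continuous_sub

open Pointwise in
/-- A difference that does not occur in a compact set does not occur in a small neighbourhood
of the set. -/
theorem IsCompact.exists_thickening_sub_ne {E : Type*} [NormedAddCommGroup E] {K : Set E}
    (hK : IsCompact K) {c : E} (h : ∀ x ∈ K, ∀ y ∈ K, y - x ≠ c) :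
    ∃ δ > 0, ∀ x ∈ thickening δ K, ∀ y ∈ thickening δ K, y - x ≠ c := by
  have hc : c ∈ (K - K)ᶜ := by
    rintro ⟨y, hy, x, hx, hxy⟩
    exact h x hx y hy hxy
  obtain ⟨ε, hε, hball⟩ := Metric.isOpen_iff.1 hK.isCompact_sub_self.isClosed.isOpen_compl c hc
  refine ⟨ε / 2, half_pos hε, fun x hx y hy hxy => ?_⟩
  obtain ⟨x', hx', hxx'⟩ := mem_thickening_iff.1 hx
  obtain ⟨y', hy', hyy'⟩ := mem_thickening_iff.1 hy
  refine hball (a := y' - x') ?_ (sub_mem_sub hy' hx')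
  rw [mem_ball, ← hxy, dist_comm]
  linarith [dist_sub_sub_le y x y' x']

theorem mem_nonChordSet_iff {K : Set (ℝ × ℝ)} {s : ℝ} :
    s ∈ nonChordSet K ↔ 0 < s ∧ ∀ x ∈ K, ∀ y ∈ K, y - x ≠ (s, 0) :=
  and_congr_right fun hs => by simp [chordSet, hs.le]

/-- Hopf's theorem. The continuum need not be path connected, so the curve is taken in a
neighbourhood of it that is still free of chords of lengths `a` and `b`. -/
theorem isAdditiveSet_nonChordSet {K : Set (ℝ × ℝ)} (hK : IsPreconnected K) (hKc : IsCompact K) :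
    IsAdditiveSet (nonChordSet K) := by
  intro a ha b hb
  rw [mem_nonChordSet_iff] at ha hb ⊢
  refine ⟨add_pos ha.1 hb.1, fun x hx y hy hxy => ?_⟩
  obtain ⟨δ, hδ, hδa⟩ := hKc.exists_thickening_sub_ne ha.2
  obtain ⟨ε, hε, hεb⟩ := hKc.exists_thickening_sub_ne hb.2
  let U := thickening (min δ ε) K
  have hKU : K ⊆ U := self_subset_thickening (lt_min hδ hε) K
  have hU : IsPathConnected U := isOpen_thickening.isConnected_iff_isPathConnected.1
    ⟨⟨x, hKU hx⟩, hK.thickening _⟩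
  obtain ⟨p, hp⟩ := hU.joinedIn x (hKU hx) y (hKU hy)
  have hpU (t : ℝ) : p.extend t ∈ U := hp _
  have hrange : IsCompact (range p.extend) := by
    rw [Path.extend_range]
    exact isCompact_range p.continuous
  have hne : (range p.extend).Nonempty := range_nonempty _
  obtain ⟨_, ⟨u, rfl⟩, hu⟩ := hrange.exists_isMaxOn hne continuous_snd.continuousOn
  obtain ⟨_, ⟨v, rfl⟩, hv⟩ := hrange.exists_isMinOn hne continuous_snd.continuousOn
  obtain ⟨s, t, h⟩ := exists_chord_of_curve (γ := fun t => Complex.equivRealProd.symm (p.extend t))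
    (Complex.equivRealProdCLM.symm.continuous.comp p.continuous_extend) ha.1 hb.1
    (by
      have h₁ : y.1 - x.1 = a + b := congrArg Prod.fst hxy
      have h₂ : y.2 - x.2 = 0 := congrArg Prod.snd hxy
      apply Complex.ext <;> simp <;> linarith)
    (u := u) (v := v) (fun t => hu (mem_range_self t)) (fun t => hv (mem_range_self t))
  have hsub (c : ℝ) (h : Complex.equivRealProd.symm (p.extend t)
      - Complex.equivRealProd.symm (p.extend s) = c) : p.extend t - p.extend s = (c, 0) :=
    Prod.ext (by simpa using congrArg Complex.re h) (by simpa using congrArg Complex.im h)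
  rcases h with h | h
  · exact hδa _ (thickening_mono (min_le_left _ _) _ (hpU s)) _
      (thickening_mono (min_le_left _ _) _ (hpU t)) (hsub a h)
  · exact hεb _ (thickening_mono (min_le_right _ _) _ (hpU s)) _
      (thickening_mono (min_le_right _ _) _ (hpU t)) (hsub b h)

open Pointwise in
theorem isClosed_chordSet {K : Set (ℝ × ℝ)} (hK : IsCompact K) : IsClosed (chordSet K) := by
  have h : chordSet K = Ici 0 ∩ (fun s : ℝ => (s, (0 : ℝ))) ⁻¹' (K - K) := by
    ext s
    simp only [chordSet, mem_ofPred_eq, mem_inter_iff, mem_Ici, mem_preimage, mem_sub]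
    grind
  rw [h]
  exact isClosed_Ici.inter (IsClosed.preimage (by fun_prop) hK.isCompact_sub_self.isClosed)

theorem theorem1 :
    (∀ K : Set (ℝ × ℝ), IsPlaneContinuum K → IsAdditiveSet (nonChordSet K)) ∧
    (∀ (L : ℝ), 0 ≤ L → ∀ f : Set.Icc (0 : ℝ) L → ℝ, Continuous f →
      IsOpen (Set.Ici (0 : ℝ) \ functionChordSet f) ∧
      IsAdditiveSet (Set.Ici (0 : ℝ) \ functionChordSet f)) := by
  refine ⟨fun K hK => isAdditiveSet_nonChordSet hK.2.1 hK.2.2, fun L hL f hf => ?_⟩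
  have hcont : Continuous fun t : Icc (0 : ℝ) L => ((t : ℝ), f t) := by fun_prop
  have : PreconnectedSpace (Icc (0 : ℝ) L) := Subtype.preconnectedSpace isPreconnected_Icc
  have hcpt : IsCompact (planeGraph f) := isCompact_range hcont
  have h₀ : 0 ∈ chordSet (planeGraph f) :=
    ⟨le_rfl, _, ⟨⟨0, le_rfl, hL⟩, rfl⟩, _, ⟨⟨0, le_rfl, hL⟩, rfl⟩, sub_self _⟩
  -- Since `0` is a chord length, excluding `0` from the complement changes nothing.
  have heq : Ici (0 : ℝ) \ functionChordSet f = nonChordSet (planeGraph f) := by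
    ext s
    refine ⟨fun h => ⟨h.1.lt_of_ne ?_, h.2⟩, fun h => ⟨h.1.le, h.2⟩⟩
    rintro rfl
    exact h.2 h₀
  rw [heq]
  exact ⟨isOpen_Ioi.inter (isClosed_chordSet hcpt).isOpen_compl,
    isAdditiveSet_nonChordSet (isPreconnected_range hcont) hcpt⟩
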